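/- Let $\{\mathcal H_k\}_{k\ge 0}$ be a concave increasing sequence of real numbers, meaning that $\mathcal H_k=\sum_{i=1}^k h_i$ for all $k\ge 0$ (so $\mathcal H_0=0$), for some monotone (weakly) decreasing sequence $h_1\ge h_2\ge\cdots$ of positive real numbers. Let $n$ and $T$ be integers with $0\le n\le T-1$ and $T\ge 3$. Then $$\sum_{s=1}^{T-1}(-1)^{s+1}R_n(s,T)\,\mathcal H_s<\sum_{s=1}^{T-1}\mathcal H_s .$$ Here $R_n(s,T)=R_n(s(s+1);0,0,T,-T)$, where $R_n(x;\alpha,\beta,\gamma,\delta)$ is the Racah polynomial $$R_n\bigl(s(s+\gamma+\delta+1);\alpha,\beta,\gamma,\delta\bigr)={}_4F_3\left(\begin{matrix}-n,\ n+\alpha+\beta+1,\ -s,\ s+\gamma+\delta+1\\ \alpha+1,\ \beta+\delta+1,\ \gamma+1\end{matrix}\,\middle|\,1\right);$$ explicitly, with $(a)_k=a(a+1)\cdots(a+k-1)$, $$R_n(s,T)=\sum_{k=0}^{n}\frac{(-n)_k\,(n+1)_k\,(-s)_k\,(s+1)_k}{(1)_k\,(1-T)_k\,(1+T)_k\,k!}.$$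 -/

import Mathlib

noncomputable section

/-- The terminating generalized hypergeometric series
`₄F₃(-n, a₂, a₃, a₄; b₁, b₂, b₃ | z) = ∑ₖ (-n)ₖ(a₂)ₖ(a₃)ₖ(a₄)ₖ / ((b₁)ₖ(b₂)ₖ(b₃)ₖ) * zᵏ/k!`,
where `(a)ₖ = a(a+1)⋯(a+k-1)`.  Since `(-n)ₖ = 0` for `k > n`, the sum runs over `0 ≤ k ≤ n`;
it is meant for lower parameters with `(bᵢ)ₖ ≠ 0` for all `k ≤ n`. -/
def terminating4F3 (n : ℕ) (a₂ a₃ a₄ b₁ b₂ b₃ z : ℝ) : ℝ :=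
  ∑ k ∈ Finset.range (n + 1),
    ((ascPochhammer ℝ k).eval (-(n : ℝ)) * (ascPochhammer ℝ k).eval a₂ *
        (ascPochhammer ℝ k).eval a₃ * (ascPochhammer ℝ k).eval a₄) /
      ((ascPochhammer ℝ k).eval b₁ * (ascPochhammer ℝ k).eval b₂ *
        (ascPochhammer ℝ k).eval b₃) *
      (z ^ k / (k.factorial : ℝ))

/-- The value `Rₙ(s(s+γ+δ+1); α, β, γ, δ)` of the Racah polynomial of degree `n`, written as a
function of the parameter `s`. -/
def racahValue (n : ℕ) (α β γ δ s : ℝ) : ℝ :=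
  terminating4F3 n (n + α + β + 1) (-s) (s + γ + δ + 1) (α + 1) (β + δ + 1) (γ + 1) 1

/-- `Rₙ(s, T) = Rₙ(s(s+1); 0, 0, T, -T)`. -/
def racahR (n s T : ℕ) : ℝ :=
  racahValue n 0 0 (T : ℝ) (-(T : ℝ)) (s : ℝ)

/-- `H` is concave increasing if `H k = h 1 + ⋯ + h k` for some (weakly) decreasing sequence
`h 1 ≥ h 2 ≥ ⋯` of positive reals; in particular `H 0 = 0`. -/
def IsConcaveIncreasing (H : ℕ → ℝ) : Prop :=
  ∃ h : ℕ → ℝ, (∀ i, 1 ≤ i → 0 < h i) ∧ AntitoneOn h (Set.Ici 1) ∧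
    ∀ k, H k = ∑ i ∈ Finset.Icc 1 k, h i

end

/-- The `k`-th forward difference of the product of an affine function with `f`. -/
theorem fwdDiff_iter_affine_mul (f : ℝ → ℝ) (c d : ℝ) (k : ℕ) (x : ℝ) :
    (fwdDiff (1 : ℝ))^[k] (fun y => (c * y + d) * f y) x =
      (c * (x + k) + d) * (fwdDiff (1 : ℝ))^[k] f x + c * k * (fwdDiff (1 : ℝ))^[k - 1] f x := by
  induction k generalizing x with
  | zero => simp
  | succ k ih =>
    rw [Function.iterate_succ_apply', fwdDiff, ih, ih, Function.iterate_succ_apply', fwdDiff]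
    rcases k with _ | k
    · simp; ring
    · simp only [Nat.add_sub_cancel, Function.iterate_succ_apply' _ k, fwdDiff]
      push_cast
      ring

/-- The `k`-th forward difference of the product of a quadratic `(x + p)(q - x)` with `f`. -/
theorem fwdDiff_iter_quadratic_mul (f : ℝ → ℝ) (p q : ℝ) (k : ℕ) (x : ℝ) :
    (fwdDiff (1 : ℝ))^[k] (fun y => (y + p) * (q - y) * f y) x =
      (x + k + p) * (q - (x + k)) * (fwdDiff (1 : ℝ))^[k] f x +
        k * (q - p - 2 * (x + k) + 1) * (fwdDiff (1 : ℝ))^[k - 1] f x -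
        k * (k - 1) * (fwdDiff (1 : ℝ))^[k - 2] f x := by
  have h : (fun y => (y + p) * (q - y) * f y) =
      fun y => (1 * y + p) * ((fun z => ((-1) * z + q) * f z) y) := by
    ext y; ring
  rw [h, fwdDiff_iter_affine_mul, fwdDiff_iter_affine_mul, fwdDiff_iter_affine_mul]
  rcases k with _ | k
  · simp
    ring
  · simp only [Nat.add_sub_cancel]
    push_cast
    ring

noncomputable section

/-- The squared matrix element `x (τ - x)` of the lowering operator of an irreducible
representation of dimension `τ`. -/
def ladderCoeff (τ x : ℝ) : ℝ := x * (τ - x)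

/-- `∏_{j < n} g(x - j)` with `g = ladderCoeff τ`: the matrix element of the `n`-th power of the
raising operator. -/
def ladderProd (τ : ℝ) (n : ℕ) (x : ℝ) : ℝ := ∏ j ∈ Finset.range n, ladderCoeff τ (x - j)

/-- The Rodrigues-type forward differences of `ladderProd`: matrix elements of spherical tensor
operators. -/
def tensorElt (τ : ℝ) (n k : ℕ) (x : ℝ) : ℝ := (fwdDiff (1 : ℝ))^[k] (ladderProd τ n) x

end

theorem tensorElt_succ (τ : ℝ) (n k : ℕ) (x : ℝ) :
    tensorElt τ n (k + 1) x = tensorElt τ n k (x + 1) - tensorElt τ n k x := by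
  simp only [tensorElt, Function.iterate_succ_apply', fwdDiff]

theorem ladderProd_succ (τ : ℝ) (n : ℕ) (x : ℝ) :
    ladderProd τ (n + 1) x = ladderProd τ n x * ladderCoeff τ (x - n) := by
  simp [ladderProd, Finset.prod_range_succ]

theorem ladderProd_succ_shift (τ : ℝ) (n : ℕ) (x : ℝ) :
    ladderProd τ (n + 1) (x + 1) = ladderCoeff τ (x + 1) * ladderProd τ n x := by
  simp only [ladderProd, Finset.prod_range_succ']
  rw [mul_comm]
  congr 1
  · simp
  · refine Finset.prod_congr rfl fun j _ => ?_
    push_cast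
    congr 1
    ring

theorem fwdDiff_ladderProd (τ : ℝ) (n : ℕ) (x : ℝ) :
    fwdDiff (1 : ℝ) (ladderProd τ (n + 1)) x =
      (n + 1) * (τ - 2 * x - 1 + n) * ladderProd τ n x := by
  rw [fwdDiff, ladderProd_succ_shift, ladderProd_succ, ladderCoeff, ladderCoeff]
  ring

/-- Pearson-type equation for `ladderProd`. -/
theorem ladderProd_pearson (τ : ℝ) (n : ℕ) (x : ℝ) :
    (x + (1 - n)) * ((τ - 1 + n) - x) * fwdDiff (1 : ℝ) (ladderProd τ n) x =
      n * (τ - 2 * x - 2 + n) * ladderProd τ n x := by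
  rcases n with _ | n
  · simp [ladderProd, fwdDiff]
  · rw [fwdDiff_ladderProd, ladderProd_succ, ladderCoeff]
    push_cast
    ring

/-- Raising the rank and the order of the difference. -/
theorem tensorElt_raise (τ : ℝ) (n k : ℕ) (x : ℝ) :
    tensorElt τ (n + 1) (k + 1) x =
      (n + 1) * ((τ - 2 * (x + k) - 1 + n) * tensorElt τ n k x -
        2 * k * tensorElt τ n (k - 1) x) := by
  have h : fwdDiff (1 : ℝ) (ladderProd τ (n + 1)) =
      fun y => ((-2 * (n + 1)) * y + (n + 1) * (τ - 1 + n)) * ladderProd τ n y := by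
    ext y
    rw [fwdDiff_ladderProd]
    ring
  rw [tensorElt, Function.iterate_succ_apply, h, fwdDiff_iter_affine_mul, tensorElt, tensorElt]
  ring

/-- The second-order difference equation in the order of the difference. -/
theorem tensorElt_casimir (τ : ℝ) (n k : ℕ) (x : ℝ) :
    ladderCoeff τ (x + k + 1 - n) * tensorElt τ n (k + 1) x =
      ((n - k) * (τ - 1 - 2 * (x + k - n)) - n * (n + 1)) * tensorElt τ n k x -
        k * (2 * n + 1 - k) * tensorElt τ n (k - 1) x := by
  have h : (fun y => (y + (1 - n)) * ((τ - 1 + n) - y) * fwdDiff (1 : ℝ) (ladderProd τ n) y) =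
      fun y => ((-2 * n) * y + n * (τ - 2 + n)) * ladderProd τ n y := by
    ext y
    rw [ladderProd_pearson]
    ring
  have h1 := congrArg (fun F => (fwdDiff (1 : ℝ))^[k] F x) h
  simp only [fwdDiff_iter_quadratic_mul, fwdDiff_iter_affine_mul,
    ← Function.iterate_succ_apply] at h1
  unfold tensorElt ladderCoeff
  rcases k with _ | _ | k
  · simp at h1 ⊢
    linear_combination h1
  · simp at h1 ⊢
    linear_combination h1
  · simp only [Nat.add_sub_cancel, Nat.succ_eq_add_one, show k + 1 + 1 - 2 = k by omega] at h1 ⊢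
    push_cast at h1 ⊢
    linear_combination h1

/-- Lowering the rank and the order of the difference. -/
theorem tensorElt_lower (τ : ℝ) (n k : ℕ) (x : ℝ) :
    (n + 1) * (τ ^ 2 - (n + 1) ^ 2) * tensorElt τ n k x =
      2 * (2 * n + 2 - k) * tensorElt τ (n + 1) k x +
        (τ + 1 - 2 * (x + k - n) + n) * tensorElt τ (n + 1) (k + 1) x := by
  have h1 := tensorElt_raise τ n k x
  rcases k with _ | k
  · simp only [tensorElt, Function.iterate_zero, id] at *
    rw [ladderProd_succ, ladderCoeff]
    rw [h1]
    push_cast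
    ring
  · have h2 := tensorElt_raise τ n k x
    have h3 := tensorElt_casimir τ n k x
    rw [ladderCoeff] at h3
    simp only [Nat.add_sub_cancel] at h1
    rw [h1, h2]
    push_cast at *
    linear_combination (4 * (n + 1)) * h3

/-- The order of the difference exceeds the degree. -/
theorem tensorElt_eq_zero_of_lt (τ : ℝ) {n k : ℕ} (h : 2 * n < k) (x : ℝ) :
    tensorElt τ n k x = 0 := by
  induction n generalizing k x with
  | zero =>
    obtain ⟨k, rfl⟩ : ∃ m, k = m + 1 := ⟨k - 1, by omega⟩
    have h0 : fwdDiff (1 : ℝ) (ladderProd τ 0) = fun _ => 0 := by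
      ext y
      simp [ladderProd, fwdDiff]
    rw [tensorElt, Function.iterate_succ_apply, h0]
    clear h h0
    induction k generalizing x with
    | zero => rfl
    | succ k ih => rw [Function.iterate_succ_apply', fwdDiff, ih, ih, sub_zero]
  | succ n ih =>
    obtain ⟨k, rfl⟩ : ∃ m, k = m + 1 := ⟨k - 1, by omega⟩
    rw [tensorElt_raise, ih (by omega), ih (k := k - 1) (by omega)]
    ring

theorem ladderProd_natCast_eq_zero (τ : ℝ) {n b : ℕ} (h : b < n) :
    ladderProd τ n (b : ℝ) = 0 :=
  Finset.prod_eq_zero (Finset.mem_range.2 h) (by simp [ladderCoeff])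

theorem tensorElt_natCast_eq_zero (τ : ℝ) {n k b : ℕ} (h : b + k < n) :
    tensorElt τ n k (b : ℝ) = 0 := by
  induction k generalizing b with
  | zero => exact ladderProd_natCast_eq_zero τ h
  | succ k ih =>
    have h1 := ih (b := b + 1) (by omega)
    push_cast at h1
    rw [tensorElt_succ, h1, ih (by omega), sub_zero]

noncomputable section

/-- The squared norm of the `a`-th basis vector on which the lowering operator acts as a shift. -/
def ladderNorm (τ : ℝ) (a : ℕ) : ℝ := ∏ i ∈ Finset.range a, ladderCoeff τ (i + 1)

/-- The normalization of the tensor operators of rank `n`. -/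
def rankNorm (τ : ℝ) (n : ℕ) : ℝ :=
  ∏ i ∈ Finset.range n, (((i : ℝ) + 1) ^ 2 * (τ ^ 2 - ((i : ℝ) + 1) ^ 2))⁻¹

/-- The stochastic kernel given by the squared matrix elements of the normalized tensor operators
of rank `n`. -/
def tensorKernel (τ : ℝ) (n a b : ℕ) : ℝ :=
  if b ≤ n + a then
    rankNorm τ n * (ladderNorm τ a / ladderNorm τ b) *
      (((2 * n - (n + a - b)).factorial : ℝ) / ((n + a - b).factorial : ℝ)) *
        tensorElt τ n (n + a - b) b ^ 2
  else 0

end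

theorem ladderNorm_succ (τ : ℝ) (a : ℕ) :
    ladderNorm τ (a + 1) = ladderNorm τ a * ladderCoeff τ (a + 1) := by
  simp [ladderNorm, Finset.prod_range_succ]

theorem ladderNorm_pos {T a : ℕ} (h : a < T) : 0 < ladderNorm T a := by
  refine Finset.prod_pos fun i hi => ?_
  have h1 : ((i : ℝ) + 1) < T := by
    have := Finset.mem_range.1 hi
    exact_mod_cast (by omega : i + 1 < T)
  exact mul_pos (by positivity) (by linarith)

theorem sq_sub_sq_pos {T n : ℕ} (h : n + 1 < T) : 0 < (T : ℝ) ^ 2 - ((n : ℝ) + 1) ^ 2 := by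
  have h1 : ((n : ℝ) + 1) < T := by exact_mod_cast h
  have h2 : (0 : ℝ) ≤ n := n.cast_nonneg
  nlinarith

theorem rankNorm_nonneg {T n : ℕ} (h : n < T) : 0 ≤ rankNorm T n := by
  refine Finset.prod_nonneg fun i hi => ?_
  have := sq_sub_sq_pos (T := T) (n := i) (by have := Finset.mem_range.1 hi; omega)
  positivity

theorem rankNorm_succ {T n : ℕ} (h : n + 1 < T) :
    rankNorm T (n + 1) * (((n : ℝ) + 1) ^ 2 * ((T : ℝ) ^ 2 - ((n : ℝ) + 1) ^ 2)) =
      rankNorm T n := by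
  have := sq_sub_sq_pos h
  rw [rankNorm, Finset.prod_range_succ, ← rankNorm, mul_assoc, inv_mul_cancel₀, mul_one]
  positivity

theorem tensorKernel_nonneg {T n a b : ℕ} (hn : n < T) (ha : a < T) (hb : b < T) :
    0 ≤ tensorKernel T n a b := by
  have h1 := rankNorm_nonneg hn
  have h2 := ladderNorm_pos ha
  have h3 := ladderNorm_pos hb
  rw [tensorKernel]
  split_ifs <;> positivity

theorem tensorKernel_of_eq (τ : ℝ) {n a b k : ℕ} (h : k + b = n + a) :
    tensorKernel τ n a b =
      rankNorm τ n * (ladderNorm τ a / ladderNorm τ b) *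
        (((2 * n - k).factorial : ℝ) / (k.factorial : ℝ)) * tensorElt τ n k b ^ 2 := by
  obtain rfl : k = n + a - b := by omega
  rw [tensorKernel, if_pos (by omega)]

theorem tensorKernel_of_lt (τ : ℝ) {n a b : ℕ} (h : n + a < b) : tensorKernel τ n a b = 0 := by
  rw [tensorKernel, if_neg (by omega)]

theorem tensorKernel_zero {T : ℕ} {a b : ℕ} (hb : b < T) :
    tensorKernel T 0 a b = if a = b then 1 else 0 := by
  rcases lt_or_ge a b with h | h
  · rw [tensorKernel_of_lt _ (by omega), if_neg (by omega)]
  · obtain ⟨k, rfl⟩ := Nat.exists_eq_add_of_le h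
    rw [tensorKernel_of_eq (k := k) _ (by omega)]
    rcases k with _ | k
    · simp [rankNorm, tensorElt, ladderProd, (ladderNorm_pos hb).ne']
    · rw [tensorElt_eq_zero_of_lt _ (by omega), if_neg (by omega)]
      simp

section Terms

variable {T n a b k : ℕ}

theorem tensorKernel_raise (hn : n + 1 < T) (h : k + b = n + a) :
    (n + 1) * ((T : ℝ) ^ 2 - (n + 1) ^ 2) / (2 * (2 * n + 1)) * tensorKernel T (n + 1) a b =
      rankNorm T n * (ladderNorm T a / ladderNorm T b) *
        (((2 * n + 1 - k).factorial : ℝ) / ((k + 1).factorial : ℝ)) *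
        ((n + 1) / (2 * (2 * n + 1)) *
          (((T - 1 - 2 * a) - n) * tensorElt T n k b - 2 * k * tensorElt T n (k - 1) b) ^ 2) := by
  have hr : (b : ℝ) + k = n + a := by exact_mod_cast (by omega : b + k = n + a)
  rw [tensorKernel_of_eq (k := k + 1) _ (by omega), tensorElt_raise, hr, ← rankNorm_succ hn,
    show 2 * (n + 1) - (k + 1) = 2 * n + 1 - k by omega]
  ring

theorem tensorKernel_lower (hn : n < T) (h : k + b = n + a) :
    n * ((T : ℝ) ^ 2 - n ^ 2) / (2 * (2 * n + 1)) * tensorKernel T (n - 1) a b =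
      rankNorm T n * (ladderNorm T a / ladderNorm T b) *
        (((2 * n - 1 - k).factorial : ℝ) * k / (k.factorial : ℝ)) *
        (n / (2 * (2 * n + 1)) *
          (2 * (2 * n + 1 - k) * tensorElt T n (k - 1) b +
            ((T - 1 - 2 * a) + n + 1) * tensorElt T n k b) ^ 2) := by
  rcases n with _ | n
  · simp
  rcases k with _ | k
  · rw [tensorKernel_of_lt _ (by omega)]
    simp
  have hr : (b : ℝ) + k = n + a := by exact_mod_cast (by omega : b + k = n + a)
  have hl := tensorElt_lower T n k b
  rw [hr] at hl
  have hl' : 2 * (2 * (((n + 1 : ℕ) : ℝ)) + 1 - ((k + 1 : ℕ) : ℝ)) * tensorElt T (n + 1) k b +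
      ((T - 1 - 2 * a) + ((n + 1 : ℕ) : ℝ) + 1) * tensorElt T (n + 1) (k + 1) b =
      (n + 1) * ((T : ℝ) ^ 2 - (n + 1) ^ 2) * tensorElt T n k b := by
    rw [hl]
    push_cast
    ring
  rw [Nat.add_sub_cancel, Nat.add_sub_cancel, hl', tensorKernel_of_eq (k := k) _ (by omega),
    ← rankNorm_succ hn, show 2 * (n + 1) - 1 - (k + 1) = 2 * n - k by omega, Nat.factorial_succ]
  push_cast
  have : (k : ℝ) + 1 ≠ 0 := by positivity
  field_simp

theorem tensorKernel_next (h : k + b = n + a) :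
    ladderCoeff T (a + 1) * tensorKernel T n (a + 1) b =
      rankNorm T n * (ladderNorm T a / ladderNorm T b) *
        (((2 * n - 1 - k).factorial : ℝ) / ((k + 1).factorial : ℝ)) *
        (((n - k) * (T - 1 - 2 * a) - n * (n + 1)) * tensorElt T n k b -
          k * (2 * n + 1 - k) * tensorElt T n (k - 1) b) ^ 2 := by
  have hr : (b : ℝ) + k = n + a := by exact_mod_cast (by omega : b + k = n + a)
  have hc := tensorElt_casimir T n k b
  rw [hr, show (n : ℝ) + a + 1 - n = a + 1 by ring, show (n : ℝ) + a - n = a by ring] at hc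
  rw [← hc, tensorKernel_of_eq (k := k + 1) _ (by omega), ladderNorm_succ,
    show 2 * n - (k + 1) = 2 * n - 1 - k by omega]
  ring

theorem tensorKernel_prev (h : k + b = n + a) :
    ladderCoeff T a * tensorKernel T n (a - 1) b =
      rankNorm T n * (ladderNorm T a / ladderNorm T b) *
        (((2 * n + 1 - k).factorial : ℝ) * k / (k.factorial : ℝ)) *
        tensorElt T n (k - 1) b ^ 2 := by
  rcases k with _ | k
  · rcases a with _ | a
    · simp [ladderCoeff]
    · rw [tensorKernel_of_lt _ (by omega)]
      simp
  · rcases a with _ | a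
    · rw [Nat.add_sub_cancel, tensorElt_natCast_eq_zero _ (by omega)]
      simp [ladderCoeff]
    · rw [Nat.add_sub_cancel, Nat.add_sub_cancel, tensorKernel_of_eq (k := k) _ (by omega),
        ladderNorm_succ, Nat.factorial_succ, show 2 * n + 1 - (k + 1) = 2 * n - k by omega]
      push_cast
      have : (k : ℝ) + 1 ≠ 0 := by positivity
      field_simp

/-- The kernels satisfy a three-term recurrence in the rank. -/
theorem tensorKernel_recurrence (hn : n + 1 < T) (ha : a < T) (hb : b < T) :
    (n + 1) * ((T : ℝ) ^ 2 - (n + 1) ^ 2) / (2 * (2 * n + 1)) * tensorKernel T (n + 1) a b +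
      n * ((T : ℝ) ^ 2 - n ^ 2) / (2 * (2 * n + 1)) * tensorKernel T (n - 1) a b +
      (n * (n + 1) - (T - 1 - 2 * a) ^ 2) / 2 * tensorKernel T n a b =
    ladderCoeff T (a + 1) * tensorKernel T n (a + 1) b +
      ladderCoeff T a * tensorKernel T n (a - 1) b := by
  have ha' := (ladderNorm_pos ha).ne'
  have hb' := (ladderNorm_pos hb).ne'
  rcases lt_or_ge (n + a) b with h | h
  · rw [tensorKernel_of_lt (n := n - 1) _ (by omega), tensorKernel_of_lt (n := n) (a := a) _ h,
      tensorKernel_of_lt (n := n) (a := a - 1) _ (by omega)]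
    rcases lt_or_eq_of_le (Nat.succ_le_of_lt h) with h | h
    · rw [tensorKernel_of_lt _ (by omega), tensorKernel_of_lt _ (by omega)]
      ring
    · obtain rfl : b = n + a + 1 := by omega
      rw [tensorKernel_of_eq (k := 0) _ (by omega), tensorKernel_of_eq (k := 0) _ (by omega),
        ladderNorm_succ _ a, ← rankNorm_succ hn]
      simp only [tensorElt, Function.iterate_zero, id, ladderProd_succ]
      rw [show (((n + a + 1 : ℕ) : ℝ)) - n = a + 1 by push_cast; ring]
      simp only [Nat.sub_zero, show 2 * (n + 1) = 2 * n + 1 + 1 by ring, Nat.factorial_succ,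
        Nat.factorial_zero]
      push_cast
      field_simp
      ring
  obtain ⟨k, hk⟩ : ∃ k, k + b = n + a := ⟨n + a - b, by omega⟩
  rw [tensorKernel_raise hn hk, tensorKernel_lower (by omega) hk, tensorKernel_next hk,
    tensorKernel_prev hk, tensorKernel_of_eq _ hk]
  have hcas := tensorElt_casimir T n k b
  have hr : (b : ℝ) + k = n + a := by exact_mod_cast (by omega : b + k = n + a)
  rw [hr, show (n : ℝ) + a - n = a by ring] at hcas
  generalize rankNorm (T : ℝ) n * (ladderNorm T a / ladderNorm T b) = c
  generalize (T : ℝ) - 1 - 2 * a = N at *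
  rcases lt_or_ge (2 * n) k with hk2 | hk2
  · rw [tensorElt_eq_zero_of_lt _ hk2]
    rcases lt_or_eq_of_le (Nat.succ_le_of_lt hk2) with h' | rfl
    · rw [tensorElt_eq_zero_of_lt _ (by omega)]
      ring
    · simp only [Nat.succ_eq_add_one, Nat.sub_self, Nat.factorial_zero, Nat.factorial_succ,
        Nat.add_sub_cancel, show 2 * n - 1 - (2 * n + 1) = 0 by omega]
      generalize tensorElt (T : ℝ) n (2 * n) b = v
      push_cast
      field_simp
      ring
  rcases lt_or_eq_of_le hk2 with hk2 | rfl
  · obtain ⟨r, hr2⟩ := Nat.exists_eq_add_of_lt hk2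
    have hn2 : (n : ℝ) = (k + r + 1) / 2 := by
      rw [eq_div_iff two_ne_zero, mul_comm]
      exact_mod_cast hr2
    rw [hr2, show k + r + 1 + 1 - k = r + 1 + 1 by omega, show k + r + 1 - 1 - k = r by omega,
      show k + r + 1 - k = r + 1 by omega]
    generalize tensorElt (T : ℝ) n k b = u at *
    generalize tensorElt (T : ℝ) n (k - 1) b = v at *
    simp only [Nat.factorial_succ, hn2]
    push_cast
    field_simp
    ring
  · rw [tensorElt_eq_zero_of_lt _ (Nat.lt_succ_self (2 * n))] at hcas
    rcases n with _ | n
    · simp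
      ring
    · have hv : tensorElt (T : ℝ) (n + 1) (2 * (n + 1)) b * (N + n + 2) =
          -2 * tensorElt (T : ℝ) (n + 1) (2 * (n + 1) - 1) b := by
        have : (n : ℝ) + 1 ≠ 0 := by positivity
        apply mul_left_cancel₀ this
        push_cast at hcas
        linear_combination hcas
      rw [show 2 * (n + 1) + 1 - 2 * (n + 1) = 1 by omega, Nat.sub_self,
        show 2 * (n + 1) - 1 - 2 * (n + 1) = 0 by omega]
      generalize tensorElt (T : ℝ) (n + 1) (2 * (n + 1)) b = u at *
      obtain ⟨v, hv'⟩ : ∃ v, tensorElt (T : ℝ) (n + 1) (2 * (n + 1) - 1) b = v := ⟨_, rfl⟩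
      rw [hv'] at hv ⊢
      obtain rfl : v = u * (N + n + 2) / (-2) := by linarith
      simp only [Nat.factorial_succ, Nat.factorial_zero]
      push_cast
      field_simp
      ring

end Terms

/-- The coefficient of `∏_{i < k} (i (i + 1) - x)` in the Racah polynomial of degree `n`. -/
noncomputable def racahCoeff (τ n : ℝ) (k : ℕ) : ℝ :=
  ∏ i ∈ Finset.range k, ((-n + i) * (n + 1 + i) / (((i : ℝ) + 1) ^ 2 * ((i + 1) ^ 2 - τ ^ 2)))

/-- The Newton basis polynomials of the Racah lattice. -/
noncomputable def racahBasis (x : ℝ) (k : ℕ) : ℝ :=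
  ∏ i ∈ Finset.range k, ((i : ℝ) * (i + 1) - x)

theorem ascPochhammer_eval_eq_prod (k : ℕ) (a : ℝ) :
    (ascPochhammer ℝ k).eval a = ∏ i ∈ Finset.range k, (a + i) := by
  induction k with
  | zero => simp
  | succ k ih => rw [ascPochhammer_succ_eval, ih, Finset.prod_range_succ]

theorem racahR_eq_sum (n s T : ℕ) :
    racahR n s T =
      ∑ k ∈ Finset.range (n + 1), racahCoeff T n k * racahBasis (s * (s + 1)) k := by
  rw [racahR, racahValue, terminating4F3]
  refine Finset.sum_congr rfl fun k _ => ?_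
  have hf : (k.factorial : ℝ) = ∏ i ∈ Finset.range k, ((i : ℝ) + 1) := by
    rw [← Finset.prod_range_add_one_eq_factorial]
    push_cast
    rfl
  simp only [ascPochhammer_eval_eq_prod, hf, one_pow, racahCoeff, racahBasis,
    ← Finset.prod_mul_distrib, ← Finset.prod_div_distrib, one_div, ← Finset.prod_inv_distrib]
  refine Finset.prod_congr rfl fun i _ => ?_
  rw [← div_eq_mul_inv, div_div, mul_div_right_comm, div_mul_eq_mul_div]
  ring

theorem racahCoeff_eq_zero {n k : ℕ} (τ : ℝ) (h : n < k) : racahCoeff τ n k = 0 :=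
  Finset.prod_eq_zero (Finset.mem_range.2 h) (by simp)

theorem racahR_eq_sum_of_le {n m : ℕ} (s T : ℕ) (h : n ≤ m) :
    racahR n s T =
      ∑ k ∈ Finset.range (m + 1), racahCoeff T n k * racahBasis (s * (s + 1)) k := by
  rw [racahR_eq_sum]
  refine Finset.sum_subset (Finset.range_mono (by omega)) fun k _ hk => ?_
  rw [racahCoeff_eq_zero _ (by simpa using hk), zero_mul]

theorem racahCoeff_num (n : ℝ) (j : ℕ) :
    let N := fun (m : ℝ) (k : ℕ) => ∏ i ∈ Finset.range k, (-m + i) * (m + 1 + i)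
    let Q := ∏ i ∈ Finset.range j, (1 - n + i) * (n + 2 + i)
    N n (j + 1) = -n * (n + 1) * Q ∧
    N n (j + 1 + 1) = -n * (n + 1) * (1 - n + j) * (n + 2 + j) * Q ∧
    N (n + 1) (j + 1 + 1) = n * (n + 1) * (n + 2 + j) * (n + 3 + j) * Q ∧
    N (n - 1) (j + 1 + 1) = n * (n + 1) * (1 - n + j) * (2 - n + j) * Q := by
  intro N Q
  have hN : ∀ m k, N m (k + 1) = N m k * ((-m + k) * (m + 1 + k)) := fun m k =>
    Finset.prod_range_succ _ _
  induction j with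
  | zero =>
    simp only [N, Q, Finset.prod_range_succ, Finset.prod_range_zero]
    push_cast
    refine ⟨by ring, by ring, by ring, by ring⟩
  | succ j ih =>
    obtain ⟨h1, h2, h3, h4⟩ := ih
    have hQ : Q = (∏ i ∈ Finset.range j, (1 - n + i) * (n + 2 + i)) *
      ((1 - n + j) * (n + 2 + j)) := Finset.prod_range_succ _ _
    rw [hN _ (j + 1 + 1), hN _ (j + 1 + 1), hN _ (j + 1 + 1), h2, h3, h4, hQ]
    push_cast
    refine ⟨by ring, by ring, by ring, by ring⟩

/-- Contiguity of the coefficients. -/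
theorem racahCoeff_contiguous (τ n : ℝ) (k : ℕ) (h : ∀ i ≤ k, ((i : ℝ) + 1) ^ 2 - τ ^ 2 ≠ 0) :
    (n + 1) * (τ ^ 2 - (n + 1) ^ 2) * racahCoeff τ (n + 1) (k + 1) +
      n * (τ ^ 2 - n ^ 2) * racahCoeff τ (n - 1) (k + 1) =
      (2 * n + 1) * (τ ^ 2 - n ^ 2 - n - 1 - 2 * (k + 1) * (k + 2)) * racahCoeff τ n (k + 1) +
        2 * (2 * n + 1) * racahCoeff τ n k := by
  have hs := racahCoeff_num n
  rcases k with _ | j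
  · have h0 := h 0 le_rfl
    simp only [racahCoeff, zero_add, Finset.prod_range_one, Finset.prod_range_zero]
    push_cast at h0 ⊢
    simp only [zero_add, one_pow, one_mul] at h0 ⊢
    field_simp
    ring
  · have h0 := h j (by omega)
    have h1 := h (j + 1) le_rfl
    obtain ⟨e1, e2, e3, e4⟩ := hs j
    simp only [racahCoeff, Finset.prod_div_distrib, e1, e2, e3, e4]
    generalize ∏ i ∈ Finset.range j, (1 - n + i) * (n + 2 + i) = Q
    have hj1 : (j : ℝ) + 1 ≠ 0 := by positivity
    have hj2 : (j : ℝ) + 1 + 1 ≠ 0 := by positivity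
    rw [Finset.prod_range_succ _ (j + 1)]
    have hD : ∏ i ∈ Finset.range (j + 1), ((i : ℝ) + 1) ^ 2 * ((i + 1) ^ 2 - τ ^ 2) ≠ 0 :=
      Finset.prod_ne_zero_iff.2 fun i hi =>
        mul_ne_zero (by positivity) (h i (by have := Finset.mem_range.1 hi; omega))
    generalize ∏ i ∈ Finset.range (j + 1), ((i : ℝ) + 1) ^ 2 * ((i + 1) ^ 2 - τ ^ 2) = D at *
    push_cast at *
    field_simp
    ring

theorem racahBasis_succ (x : ℝ) (k : ℕ) :
    racahBasis x (k + 1) = racahBasis x k * (k * (k + 1) - x) := by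
  simp [racahBasis, Finset.prod_range_succ]

theorem racahCoeff_partial_sum (τ n x : ℝ) (k : ℕ)
    (h : ∀ i < k, ((i : ℝ) + 1) ^ 2 - τ ^ 2 ≠ 0) :
    ∑ j ∈ Finset.range (k + 1),
      ((n + 1) * (τ ^ 2 - (n + 1) ^ 2) * racahCoeff τ (n + 1) j +
        n * (τ ^ 2 - n ^ 2) * racahCoeff τ (n - 1) j -
        (2 * n + 1) * (τ ^ 2 - n ^ 2 - n - 1 - 2 * x) * racahCoeff τ n j) * racahBasis x j =
      -2 * (2 * n + 1) * racahCoeff τ n k * racahBasis x (k + 1) := by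
  induction k with
  | zero => simp [racahCoeff, racahBasis]; ring
  | succ k ih =>
    rw [Finset.sum_range_succ, ih fun i hi => h i (by omega)]
    have hc := racahCoeff_contiguous τ n k fun i hi => h i (by omega)
    rw [racahBasis_succ x (k + 1)]
    push_cast
    linear_combination racahBasis x (k + 1) * hc

/-- Three-term recurrence of the Racah polynomials. -/
theorem racahR_recurrence {n T : ℕ} (s : ℕ) (hn : n + 1 < T) :
    (n + 1) * ((T : ℝ) ^ 2 - (n + 1) ^ 2) * racahR (n + 1) s T +
      n * ((T : ℝ) ^ 2 - n ^ 2) * racahR (n - 1) s T =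
    (2 * n + 1) * ((T : ℝ) ^ 2 - n ^ 2 - n - 1 - 2 * (s * (s + 1))) * racahR n s T := by
  have h := racahCoeff_partial_sum T n (s * (s + 1)) (n + 1) fun i hi => by
    have := sq_sub_sq_pos (T := T) (n := i) (by omega)
    linarith
  rw [racahCoeff_eq_zero _ (Nat.lt_succ_self n)] at h
  have h0 : n * ((T : ℝ) ^ 2 - n ^ 2) * racahR (n - 1) s T =
      n * ((T : ℝ) ^ 2 - n ^ 2) * ∑ k ∈ Finset.range (n + 1 + 1),
        racahCoeff T ((n : ℝ) - 1) k * racahBasis (s * (s + 1)) k := by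
    rcases n with _ | n
    · simp
    · rw [racahR_eq_sum_of_le s T (show n + 1 - 1 ≤ n + 1 + 1 by omega)]
      push_cast
      simp
  rw [h0, racahR_eq_sum_of_le s T (le_refl (n + 1)),
    racahR_eq_sum_of_le s T (show n ≤ n + 1 by omega)]
  simp only [sub_mul, add_mul, Finset.sum_sub_distrib, Finset.sum_add_distrib, mul_assoc,
    ← Finset.mul_sum] at h ⊢
  push_cast
  linarith

/-- The discrete Chebyshev polynomials are eigenvectors of the Jacobi operator. -/
theorem tensorElt_diag_eigen (τ : ℝ) (s : ℕ) (x : ℝ) :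
    ladderCoeff τ (x + 1) * tensorElt τ s s (x + 1) + ladderCoeff τ x * tensorElt τ s s (x - 1) =
      (ladderCoeff τ (x + 1) + ladderCoeff τ x - s * (s + 1)) * tensorElt τ s s x := by
  have h1 := tensorElt_casimir τ s s x
  have h2 := tensorElt_casimir τ s s (x - 1)
  have e1 := tensorElt_succ τ s s x
  have e2 := tensorElt_succ τ s s (x - 1)
  rw [show x + s + 1 - s = x + 1 by ring] at h1
  rw [show x - 1 + s + 1 - s = x by ring] at h2
  rw [sub_add_cancel] at e2
  rw [e1] at h1
  rw [e2] at h2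
  rcases s with _ | s
  · push_cast at *
    linear_combination h1 - h2
  · have e3 := tensorElt_succ τ (s + 1) s (x - 1)
    rw [sub_add_cancel] at e3
    rw [Nat.add_sub_cancel] at h1 h2
    push_cast at *
    linear_combination h1 - h2 + (s + 1) * (s + 2) * e3

theorem tensorElt_diag_zero_ne_zero {s T : ℕ} (h : s < T) : tensorElt T s s 0 ≠ 0 := by
  have key : ∀ k b : ℕ, b + k = s → tensorElt T s k b = ladderProd T s s := by
    intro k
    induction k with
    | zero =>
      rintro b rfl
      rfl
    | succ k ih =>
      intro b hb
      have h1 := ih (b + 1) (by omega)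
      push_cast at h1
      rw [tensorElt_succ, h1, tensorElt_natCast_eq_zero _ (by omega), sub_zero]
  have h0 := key s 0 (by omega)
  rw [Nat.cast_zero] at h0
  rw [h0]
  refine Finset.prod_ne_zero_iff.2 fun j hj => ?_
  have hj' := Finset.mem_range.1 hj
  have h1 : (j : ℝ) < s := by exact_mod_cast hj'
  have h2 : (s : ℝ) < T := by exact_mod_cast h
  have h3 : (0 : ℝ) ≤ j := j.cast_nonneg
  exact (mul_pos (by linarith) (by linarith)).ne'

/-- Summation by parts against a weight vanishing at both ends. -/
theorem sum_mul_shift_comm (T : ℕ) (g t M : ℕ → ℝ) (h0 : g 0 = 0) (hT : g T = 0) :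
    ∑ a ∈ Finset.range T, t a * (g (a + 1) * M (a + 1) + g a * M (a - 1)) =
      ∑ a ∈ Finset.range T, (g (a + 1) * t (a + 1) + g a * t (a - 1)) * M a := by
  have key : ∀ u v : ℕ → ℝ, ∑ a ∈ Finset.range T, u a * (g (a + 1) * v (a + 1)) =
      ∑ a ∈ Finset.range T, g a * u (a - 1) * v a := by
    intro u v
    have h1 := Finset.sum_range_succ (fun a => g a * u (a - 1) * v a) T
    rw [Finset.sum_range_succ', h0, hT] at h1
    simp only [Nat.add_sub_cancel, zero_mul, add_zero] at h1
    rw [← h1]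
    exact Finset.sum_congr rfl fun a _ => by ring
  have k1 := key t M
  have k2 := key M t
  simp only [mul_add, add_mul, Finset.sum_add_distrib]
  rw [k1, add_comm]
  congr 1
  trans ∑ a ∈ Finset.range T, g a * M (a - 1) * t a
  · exact Finset.sum_congr rfl fun a _ => by ring
  · rw [← k2]
    exact Finset.sum_congr rfl fun a _ => by ring

/-- The kernel of rank `n` acts on the `s`-th discrete Chebyshev polynomial by the scalar
`racahR n s T`. -/
theorem sum_tensorKernel {n s T b : ℕ} (hn : n < T) (hb : b < T) :
    ∑ a ∈ Finset.range T, tensorElt T s s a * tensorKernel T n a b =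
      racahR n s T * tensorElt T s s b := by
  have zero : ∑ a ∈ Finset.range T, tensorElt T s s a * tensorKernel T 0 a b =
      racahR 0 s T * tensorElt T s s b := by
    simp [tensorKernel_zero hb, hb, racahR_eq_sum, racahCoeff, racahBasis]
  have step : ∀ n, n + 1 < T →
      (∑ a ∈ Finset.range T, tensorElt T s s a * tensorKernel T n a b =
        racahR n s T * tensorElt T s s b) →
      (∑ a ∈ Finset.range T, tensorElt T s s a * tensorKernel T (n - 1) a b =
        racahR (n - 1) s T * tensorElt T s s b) →
      ∑ a ∈ Finset.range T, tensorElt T s s a * tensorKernel T (n + 1) a b =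
        racahR (n + 1) s T * tensorElt T s s b := by
    intro n hn h1 h2
    have hsum := sum_mul_shift_comm T (fun a => ladderCoeff T a) (fun a => tensorElt T s s a)
      (fun a => tensorKernel T n a b) (by simp [ladderCoeff]) (by simp [ladderCoeff])
    have hR := racahR_recurrence s hn
    have hpos := sq_sub_sq_pos hn
    have e1 : ∀ a ∈ Finset.range T, tensorElt (T : ℝ) s s a *
        (ladderCoeff T ((a + 1 : ℕ) : ℝ) * tensorKernel T n (a + 1) b +
          ladderCoeff T a * tensorKernel T n (a - 1) b) =
        (n + 1) * ((T : ℝ) ^ 2 - (n + 1) ^ 2) / (2 * (2 * n + 1)) *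
          (tensorElt T s s a * tensorKernel T (n + 1) a b) +
        n * ((T : ℝ) ^ 2 - n ^ 2) / (2 * (2 * n + 1)) *
          (tensorElt T s s a * tensorKernel T (n - 1) a b) +
        (n * (n + 1) - (T - 1 - 2 * a) ^ 2) / 2 *
          (tensorElt T s s a * tensorKernel T n a b) := by
      intro a ha
      have := tensorKernel_recurrence hn (Finset.mem_range.1 ha) hb
      push_cast
      rw [← this]
      ring
    have e2 : ∀ a ∈ Finset.range T,
        (ladderCoeff T ((a + 1 : ℕ) : ℝ) * tensorElt T s s ((a + 1 : ℕ) : ℝ) +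
          ladderCoeff T a * tensorElt T s s ((a - 1 : ℕ) : ℝ)) * tensorKernel T n a b =
        (((T : ℝ) ^ 2 - 1) / 2 - s * (s + 1)) * (tensorElt T s s a * tensorKernel T n a b) +
        (- (T - 1 - 2 * a) ^ 2) / 2 * (tensorElt T s s a * tensorKernel T n a b) := by
      intro a _
      have h := tensorElt_diag_eigen T s a
      have h' : ladderCoeff T a * tensorElt T s s ((a - 1 : ℕ) : ℝ) =
          ladderCoeff T a * tensorElt T s s ((a : ℝ) - 1) := by
        rcases a with _ | a
        · simp [ladderCoeff]
        · simp
      rw [h']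
      push_cast
      rw [h]
      unfold ladderCoeff
      ring
    rw [Finset.sum_congr rfl e1, Finset.sum_congr rfl e2, Finset.sum_add_distrib,
      Finset.sum_add_distrib, Finset.sum_add_distrib, ← Finset.mul_sum, ← Finset.mul_sum,
      ← Finset.mul_sum, h1, h2] at hsum
    have e3 : ∑ a ∈ Finset.range T, ((n : ℝ) * (n + 1) - (T - 1 - 2 * a) ^ 2) / 2 *
          (tensorElt T s s a * tensorKernel T n a b) =
        n * (n + 1) / 2 * (racahR n s T * tensorElt T s s b) +
        ∑ a ∈ Finset.range T, (- ((T : ℝ) - 1 - 2 * a) ^ 2) / 2 *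
          (tensorElt T s s a * tensorKernel T n a b) := by
      rw [← h1, Finset.mul_sum, ← Finset.sum_add_distrib]
      exact Finset.sum_congr rfl fun a _ => by ring
    rw [e3] at hsum
    have hne : ((n : ℝ) + 1) * ((T : ℝ) ^ 2 - (n + 1) ^ 2) ≠ 0 := by positivity
    have h2n : (2 * (n : ℝ) + 1) ≠ 0 := by positivity
    apply mul_left_cancel₀ hne
    generalize ∑ a ∈ Finset.range T, (- ((T : ℝ) - 1 - 2 * a) ^ 2) / 2 *
          (tensorElt T s s a * tensorKernel T n a b) = Z at hsum
    field_simp at hsum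
    linear_combination hsum - tensorElt T s s b * hR
  have both : ∀ m, m < T →
      (∑ a ∈ Finset.range T, tensorElt T s s a * tensorKernel T m a b =
        racahR m s T * tensorElt T s s b) ∧
      (∑ a ∈ Finset.range T, tensorElt T s s a * tensorKernel T (m - 1) a b =
        racahR (m - 1) s T * tensorElt T s s b) := by
    intro m
    induction m with
    | zero => exact fun _ => ⟨zero, zero⟩
    | succ m ih =>
      intro hm
      obtain ⟨h1, h2⟩ := ih (by omega)
      exact ⟨step m hm h1 h2, h1⟩
  exact (both n hn).1

theorem racahR_zero_right (n T : ℕ) : racahR n 0 T = 1 := by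
  rw [racahR_eq_sum, Finset.sum_range_succ', Finset.sum_eq_zero]
  · simp [racahCoeff, racahBasis]
  · intro k _
    rw [racahBasis, Finset.prod_range_succ']
    simp

theorem sum_tensorKernel_eq_one {n T b : ℕ} (hn : n < T) (hb : b < T) :
    ∑ a ∈ Finset.range T, tensorKernel T n a b = 1 := by
  have h := sum_tensorKernel (s := 0) hn hb
  simpa [racahR_zero_right, tensorElt, ladderProd] using h

/-- The Racah polynomials `R_n(s, T)` are bounded by one in absolute value. -/
theorem abs_racahR_le_one {n s T : ℕ} (hn : n < T) (hs : s < T) : |racahR n s T| ≤ 1 := by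
  obtain ⟨b, hb, hmax⟩ := Finset.exists_max_image (Finset.range T)
    (fun a => |tensorElt T s s (a : ℝ)|) ⟨0, Finset.mem_range.2 (by omega)⟩
  have hb' := Finset.mem_range.1 hb
  have hpos : 0 < |tensorElt T s s (b : ℝ)| := by
    refine lt_of_lt_of_le (abs_pos.2 (tensorElt_diag_zero_ne_zero hs)) ?_
    simpa using hmax 0 (Finset.mem_range.2 (by omega))
  refine le_of_mul_le_mul_right ?_ hpos
  rw [one_mul, ← abs_mul, ← sum_tensorKernel hn hb']
  calc |∑ a ∈ Finset.range T, tensorElt T s s a * tensorKernel T n a b|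
      ≤ ∑ a ∈ Finset.range T, |tensorElt T s s a * tensorKernel T n a b| :=
        Finset.abs_sum_le_sum_abs _ _
    _ ≤ ∑ a ∈ Finset.range T, |tensorElt T s s b| * tensorKernel T n a b := by
        refine Finset.sum_le_sum fun a ha => ?_
        have hM := tensorKernel_nonneg hn (Finset.mem_range.1 ha) hb'
        rw [abs_mul, abs_of_nonneg hM]
        exact mul_le_mul_of_nonneg_right (hmax a ha) hM
    _ = |tensorElt T s s b| := by
        rw [← Finset.mul_sum, sum_tensorKernel_eq_one hn hb', mul_one]

theorem racahR_zero_left (s T : ℕ) : racahR 0 s T = 1 := by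
  simp [racahR_eq_sum, racahCoeff, racahBasis]

theorem racahR_one_right {n : ℕ} (T : ℕ) (hn : 1 ≤ n) :
    racahR n 1 T = 1 - 2 * (n * (n + 1)) / ((T : ℝ) ^ 2 - 1) := by
  obtain ⟨n, rfl⟩ : ∃ m, n = m + 1 := ⟨n - 1, by omega⟩
  rw [racahR_eq_sum, Finset.sum_range_succ', Finset.sum_range_succ', Finset.sum_eq_zero]
  · simp [racahCoeff, racahBasis]
    rw [← neg_sub ((T : ℝ) ^ 2) 1, div_neg]
    ring
  · intro k _
    rw [racahBasis, Finset.prod_range_succ', Finset.prod_range_succ']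
    norm_num

theorem IsConcaveIncreasing.pos {H : ℕ → ℝ} (hH : IsConcaveIncreasing H) {k : ℕ} (hk : 1 ≤ k) :
    0 < H k := by
  obtain ⟨h, hpos, -, hsum⟩ := hH
  rw [hsum]
  exact Finset.sum_pos (fun i hi => hpos i (Finset.mem_Icc.1 hi).1) ⟨1, by simp [hk]⟩

theorem mainTheorem2 (H : ℕ → ℝ) (hH : IsConcaveIncreasing H) (n T : ℕ)
    (hT : 3 ≤ T) (hn : n ≤ T - 1) :
    ∑ s ∈ Finset.Icc 1 (T - 1), (-1 : ℝ) ^ (s + 1) * racahR n s T * H s <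
      ∑ s ∈ Finset.Icc 1 (T - 1), H s := by
  refine Finset.sum_lt_sum (fun s hs => ?_) ?_
  · obtain ⟨h1, h2⟩ := Finset.mem_Icc.1 hs
    refine mul_le_of_le_one_left (hH.pos h1).le ((le_abs_self _).trans ?_)
    rw [abs_mul, abs_neg_one_pow, one_mul]
    exact abs_racahR_le_one (by omega) (by omega)
  · rcases Nat.eq_zero_or_pos n with rfl | hn0
    · refine ⟨2, Finset.mem_Icc.2 ⟨by omega, by omega⟩, ?_⟩
      rw [racahR_zero_left]
      have := hH.pos (k := 2) (by omega)
      norm_num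
      linarith
    · refine ⟨1, Finset.mem_Icc.2 ⟨le_rfl, by omega⟩, ?_⟩
      refine mul_lt_of_lt_one_left (hH.pos le_rfl) ?_
      rw [racahR_one_right T hn0]
      have h1 : (0 : ℝ) < n := by exact_mod_cast hn0
      have h2 : (3 : ℝ) ≤ T := by exact_mod_cast hT
      have h3 : (0 : ℝ) < (T : ℝ) ^ 2 - 1 := by nlinarith
      have : 0 < 2 * ((n : ℝ) * (n + 1)) / ((T : ℝ) ^ 2 - 1) := by positivity
      norm_num
      linarith
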